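/- Let $\alpha=(\alpha_n)_{n\ge 1}\subset(1,\infty)$ be strictly increasing with $\alpha_n\to\infty$. For $k,n\in\mathbb N=\{1,2,\dots\}$ put $w_k(n):=e^{-\alpha_n/k}$, and let $c_0(w_k)$ be the Banach space of all complex sequences $x$ with $\lim_n w_k(n)|x_n|=0$, with norm $p_k(x)=\sup_n w_k(n)|x_n|$. Let $\Lambda_0(\alpha)=\bigcap_{k} c_0(w_k)$ be the power series space of finite type, a Fréchet space with the topology generated by the norms $p_k$, $k\in\mathbb N$. The discrete Cesàro operator $\mathsf C x=\bigl(\tfrac1n\sum_{i=1}^n x_i\bigr)_{n\ge1}$ is a continuous linear operator on $\Lambda_0(\alpha)$ and on each $c_0(w_k)$. For a continuous linear operator $T$ on a locally convex Hausdorff space $X$, $\rho(T)$ is the set of $\lambda\in\mathbb C$ such that $\lambda I-T$ has an inverse in the algebra $\mathcal L(X)$ of continuous linear operators, $\sigma(T;X)=\mathbb C\setminus\rho(T)$; $\rho^*(T)$ is the set of $\lambda$ for which there is $\delta>0$ such that $B(\lambda,\delta)=\{\mu:|\mu-\lambda|<\delta\}\subseteq\rho(T)$ and $\{(\mu I-T)^{-1}:\mu\in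 B(\lambda,\delta)\}$ is equicontinuous, and $\sigma^*(T;X)=\mathbb C\setminus\rho^*(T)$. For $k\in\mathbb N$ let $S_k(\alpha)=\{s\in\mathbb R:\sum_{n=1}^\infty e^{\alpha_n/k}/n^s<\infty\}$ and $s_0(k)=\inf S_k(\alpha)$; for $r\ge1$ let $D(r)=\{\lambda\in\mathbb C:|\lambda-\frac1{2r}|<\frac1{2r}\}$; let $\Sigma=\{\frac1m:m\in\mathbb N\}$. Suppose that $S_1(\alpha)\neq\emptyset$, i.e. $\sum_n e^{\alpha_n}/n^s<\infty$ for some real $s$. Then $\Lambda_0(\alpha)$ is not nuclear, $S_k(\alpha)\ne\emptyset$ and $s_0(k)\ge1$ for every $k$, and $$D(1)\cup\{1\}=\bigcup_{k\in\mathbb N}D(s_0(k))\cup\Sigma\subseteq\sigma(\mathsf C;\Lambda_0(\alpha)),$$ $$\sigma(\mathsf C;\Lambda_0(\alpha))\subseteq\bigcup_{k\in\mathbb N}\sigma(\mathsf C;c_0(w_k))\subseteq\overline{D(1)},$$ $$\sigma^*(\mathsf C;\Lambda_0(\alpha))=\overline{\sigma(\mathsf C;\Lambda_0(\alpha))}=\overline{D(1)}=\{\lambda\in\mathbb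 C:|\lambda-\tfrac12|\le\tfrac12\}.$$ -/

import Mathlib

open Filter Topology
open scoped NNReal

noncomputable section

/-! ### Generalities on operators on locally convex spaces

The resolvent set, the spectrum and the resolvent `(μ I - T)⁻¹` of a continuous linear operator
`T : X →L[ℂ] X` are those of Mathlib (`resolventSet ℂ T`, `spectrum ℂ T`, `resolvent T μ`), taken
in the algebra `X →L[ℂ] X` of all continuous linear operators. -/

/-- `ρ*(T)`: the set of all `z` having a disc around them that lies in the resolvent set of `T` and
on which the resolvents form an equicontinuous set of operators. -/
def resolventSetStar {X : Type*} [AddCommGroup X] [Module ℂ X] [TopologicalSpace X]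
    [IsTopologicalAddGroup X] [ContinuousSMul ℂ X] (T : X →L[ℂ] X) : Set ℂ :=
  {z | ∃ δ : ℝ, 0 < δ ∧ Metric.ball z δ ⊆ resolventSet ℂ T ∧
    ∀ U ∈ 𝓝 (0 : X), ∃ V ∈ 𝓝 (0 : X), ∀ μ ∈ Metric.ball z δ, ∀ x ∈ V, resolvent T μ x ∈ U}

/-- `σ*(T)`, the complement of `ρ*(T)`. -/
def spectrumStar {X : Type*} [AddCommGroup X] [Module ℂ X] [TopologicalSpace X]
    [IsTopologicalAddGroup X] [ContinuousSMul ℂ X] (T : X →L[ℂ] X) : Set ℂ :=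
  (resolventSetStar T)ᶜ

/-- Nuclearity of a locally convex space: for each continuous seminorm `p` there is a continuous
seminorm `q` such that the canonical map from the local Banach space of `q` to that of `p` is
nuclear, i.e. is given by a series `∑ j, f j ⊗ y j` with the `f j` in the polar of the unit ball
of `q` and `∑ j, p (y j) < ∞` (by density, the `y j` may be taken in the space itself). -/
def IsNuclearSpace (X : Type*) [AddCommGroup X] [Module ℂ X] [TopologicalSpace X] : Prop :=
  ∀ p : Seminorm ℂ X, Continuous p → ∃ q : Seminorm ℂ X, Continuous q ∧
    ∃ (f : ℕ → X →ₗ[ℂ] ℂ) (y : ℕ → X), (∀ j x, ‖f j x‖ ≤ q x) ∧ Summable (fun j => p (y j)) ∧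
      ∀ x : X, Tendsto (fun N : ℕ => p (x - ∑ j ∈ Finset.range N, f j x • y j)) atTop (𝓝 0)

/-! ### Köthe echelon spaces of order `0`

All sequences are indexed by `ℕ = {0, 1, 2, …}`: the entry with index `n` is the `(n + 1)`-st
term of the sequence. -/

/-- The vector space `{x ∈ ℂ^ℕ : lim_n a_k(n) |x_n| = 0 for all k}`. -/
def kotheSubmodule {ι : Type*} (a : ι → ℕ → ℝ≥0) : Submodule ℂ (ℕ → ℂ) where
  carrier := {x | ∀ k, Tendsto (fun n => (a k n : ℝ) * ‖x n‖) atTop (𝓝 0)}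
  zero_mem' := fun k => by simp
  add_mem' := by
    intro x y hx hy k
    have h := (hx k).add (hy k)
    rw [add_zero] at h
    refine squeeze_zero (fun n => by positivity) (fun n => ?_) h
    rw [← mul_add]
    exact mul_le_mul_of_nonneg_left (norm_add_le _ _) (a k n).2
  smul_mem' := by
    intro c x hx k
    have h := (hx k).const_mul ‖c‖
    rw [mul_zero] at h
    refine h.congr (fun n => ?_)
    simp only [Pi.smul_apply, smul_eq_mul, norm_mul]
    ring

/-- The Köthe echelon space of order `0` of the family of weights `a`. It is a type of its own, so
that it does not carry the topology of coordinatewise convergence. -/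
def KotheZero {ι : Type*} (a : ι → ℕ → ℝ≥0) : Type := ↥(kotheSubmodule a)

namespace KotheZero

variable {ι : Type*} (a : ι → ℕ → ℝ≥0)

instance : AddCommGroup (KotheZero a) := inferInstanceAs (AddCommGroup ↥(kotheSubmodule a))

instance : Module ℂ (KotheZero a) := inferInstanceAs (Module ℂ ↥(kotheSubmodule a))

variable {a}

/-- The underlying sequence of an element of the space. -/
def seq (x : KotheZero a) : ℕ → ℂ := Subtype.val (p := fun y => y ∈ kotheSubmodule a) x

theorem tendsto_seq (x : KotheZero a) (k : ι) :
    Tendsto (fun n => (a k n : ℝ) * ‖x.seq n‖) atTop (𝓝 0) :=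
  Subtype.property (p := fun y => y ∈ kotheSubmodule a) x k

@[simp] theorem seq_add (x y : KotheZero a) (n : ℕ) : (x + y).seq n = x.seq n + y.seq n := rfl

@[simp] theorem seq_smul (c : ℂ) (x : KotheZero a) (n : ℕ) : (c • x).seq n = c * x.seq n := rfl

theorem bddAbove_seq (x : KotheZero a) (k : ι) :
    BddAbove (Set.range fun n => (a k n : ℝ) * ‖x.seq n‖) :=
  (x.tendsto_seq k).bddAbove_range

variable (a)

/-- The canonical seminorms `p_k(x) = sup_n a_k(n) |x_n|`. -/
def canonicalSeminorm : SeminormFamily ℂ (KotheZero a) ι := fun k =>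
  Seminorm.of (fun x => ⨆ n, (a k n : ℝ) * ‖x.seq n‖)
    (fun x y => ciSup_le fun n => by
      refine le_trans ?_ (add_le_add (le_ciSup (x.bddAbove_seq k) n)
        (le_ciSup (y.bddAbove_seq k) n))
      rw [← mul_add]
      exact mul_le_mul_of_nonneg_left (norm_add_le _ _) (a k n).2)
    (fun c x => by
      rw [Real.mul_iSup_of_nonneg (norm_nonneg c)]
      refine congrArg iSup (funext fun n => ?_)
      rw [seq_smul, norm_mul]
      ring)

/-- The locally convex topology generated by the canonical seminorms. -/
instance [Nonempty ι] : TopologicalSpace (KotheZero a) :=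
  (canonicalSeminorm a).moduleFilterBasis.topology

theorem withSeminorms [Nonempty ι] : WithSeminorms (canonicalSeminorm a) := ⟨rfl⟩

instance [Nonempty ι] : IsTopologicalAddGroup (KotheZero a) := (withSeminorms a).topologicalAddGroup

instance [Nonempty ι] : ContinuousSMul ℂ (KotheZero a) := (withSeminorms a).continuousSMul

end KotheZero

/-! ### The Cesàro operator -/

/-- The discrete Cesàro operator on `ℂ^ℕ`,
`(x_1, x_2, …) ↦ (x_1, (x_1 + x_2) / 2, (x_1 + x_2 + x_3) / 3, …)`. -/
def cesaroSeq : (ℕ → ℂ) →ₗ[ℂ] (ℕ → ℂ) where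
  toFun x n := (∑ i ∈ Finset.range (n + 1), x i) / ((n : ℂ) + 1)
  map_add' x y := by
    funext n
    simp only [Pi.add_apply, Finset.sum_add_distrib, add_div]
  map_smul' c x := by
    funext n
    simp only [Pi.smul_apply, smul_eq_mul, RingHom.id_apply, ← Finset.mul_sum, mul_div_assoc]

theorem weight_mul_norm_cesaroSeq_le {w : ℕ → ℝ≥0} (hw : Antitone w) (x : ℕ → ℂ) (n : ℕ) :
    (w n : ℝ) * ‖cesaroSeq x n‖ ≤
      ((n : ℝ) + 1)⁻¹ * ∑ i ∈ Finset.range (n + 1), (w i : ℝ) * ‖x i‖ := by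
  have h1 : ‖cesaroSeq x n‖ = ((n : ℝ) + 1)⁻¹ * ‖∑ i ∈ Finset.range (n + 1), x i‖ := by
    have h2 : ‖(n : ℂ) + 1‖ = (n : ℝ) + 1 := by
      have := Complex.norm_natCast (n + 1)
      push_cast at this
      exact this
    change ‖(∑ i ∈ Finset.range (n + 1), x i) / ((n : ℂ) + 1)‖ = _
    rw [norm_div, h2, div_eq_inv_mul]
  rw [h1, mul_left_comm]
  refine mul_le_mul_of_nonneg_left ?_ (by positivity)
  refine (mul_le_mul_of_nonneg_left (norm_sum_le _ _) (w n).2).trans ?_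
  rw [Finset.mul_sum]
  refine Finset.sum_le_sum fun i hi => ?_
  have hi' : i ≤ n := Nat.lt_succ_iff.mp (Finset.mem_range.mp hi)
  exact mul_le_mul_of_nonneg_right (NNReal.coe_le_coe.mpr (hw hi')) (norm_nonneg _)

theorem cesaroSeq_mem {ι : Type*} {a : ι → ℕ → ℝ≥0} (ha : ∀ k, Antitone (a k))
    (x : KotheZero a) : cesaroSeq x.seq ∈ kotheSubmodule a := by
  intro k
  have h := ((x.tendsto_seq k).cesaro).comp (tendsto_add_atTop_nat 1)
  refine squeeze_zero (fun n => by positivity)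
    (fun n => weight_mul_norm_cesaroSeq_le (ha k) x.seq n) (h.congr fun n => ?_)
  simp

/-- The Cesàro operator as a continuous linear operator on a Köthe echelon space of order `0` with
decreasing weights. -/
def KotheZero.cesaro {ι : Type*} [Nonempty ι] (a : ι → ℕ → ℝ≥0) (ha : ∀ k, Antitone (a k)) :
    KotheZero a →L[ℂ] KotheZero a where
  toFun x := (⟨cesaroSeq x.seq, cesaroSeq_mem ha x⟩ : ↥(kotheSubmodule a))
  map_add' x y := Subtype.ext (cesaroSeq.map_add x.seq y.seq)
  map_smul' c x := Subtype.ext (cesaroSeq.map_smul c x.seq)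
  cont := by
    let T : KotheZero a →ₗ[ℂ] KotheZero a :=
      { toFun := fun x => (⟨cesaroSeq x.seq, cesaroSeq_mem ha x⟩ : ↥(kotheSubmodule a))
        map_add' := fun x y => Subtype.ext (cesaroSeq.map_add x.seq y.seq)
        map_smul' := fun c x => Subtype.ext (cesaroSeq.map_smul c x.seq) }
    refine WithSeminorms.continuous_of_isBounded (KotheZero.withSeminorms a)
      (KotheZero.withSeminorms a) T (fun k => ⟨{k}, 1, ?_⟩)
    intro x
    rw [Finset.sup_singleton, one_smul]
    change (⨆ n, (a k n : ℝ) * ‖cesaroSeq x.seq n‖) ≤ ⨆ n, (a k n : ℝ) * ‖x.seq n‖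
    refine ciSup_le fun n => (weight_mul_norm_cesaroSeq_le (ha k) x.seq n).trans ?_
    rw [inv_mul_le_iff₀ (by positivity)]
    refine (Finset.sum_le_card_nsmul _ _ _ fun i _ => le_ciSup (x.bddAbove_seq k) i).trans ?_
    rw [Finset.card_range, nsmul_eq_mul]
    push_cast
    exact le_rfl

/-! ### Power series spaces of finite type -/

/-- The weights `w_k(n) = e^{-α_n / k}`, `k = 1, 2, …`. As `k` is also counted from `0` here, the
weight with index `k` is the `(k + 1)`-st one. -/
def powerWeight (α : ℕ → ℝ) (k n : ℕ) : ℝ≥0 :=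
  ⟨Real.exp (-(α n / ((k : ℝ) + 1))), (Real.exp_pos _).le⟩

theorem powerWeight_antitone {α : ℕ → ℝ} (hα : Monotone α) (k : ℕ) :
    Antitone (powerWeight α k) := by
  intro m n hmn
  refine NNReal.coe_le_coe.mp (Real.exp_le_exp.mpr (neg_le_neg ?_))
  exact div_le_div_of_nonneg_right (hα hmn) (by positivity)

/-- The power series space of finite type `Λ_0(α) = ⋂_k c_0(w_k)`. -/
abbrev PowerSeriesZero (α : ℕ → ℝ) : Type := KotheZero (powerWeight α)

/-- The weighted Banach space `c_0(w)`, with the topology of the norm `sup_n w(n) |x_n|`: the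
echelon space of a single weight. -/
abbrev WeightedC0 (w : ℕ → ℝ≥0) : Type := KotheZero fun _ : Unit => w

/-- The Cesàro operator on `Λ_0(α)`. -/
def cesaroPower (α : ℕ → ℝ) (hα : Monotone α) : PowerSeriesZero α →L[ℂ] PowerSeriesZero α :=
  KotheZero.cesaro (powerWeight α) (powerWeight_antitone hα)

/-- The Cesàro operator on `c_0(w)`, for a decreasing weight `w`. -/
def cesaroWeighted (w : ℕ → ℝ≥0) (hw : Antitone w) : WeightedC0 w →L[ℂ] WeightedC0 w :=
  KotheZero.cesaro (fun _ : Unit => w) fun _ => hw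

/-- `S_k(α)`: the set of real `s` with `∑_n e^{α_n / k} / n^s < ∞` (the terms are positive). -/
def exponentSet (α : ℕ → ℝ) (k : ℕ) : Set ℝ :=
  {s | Summable fun n : ℕ => Real.exp (α n / ((k : ℝ) + 1)) / ((n : ℝ) + 1) ^ s}

/-- `s_0(k) = inf S_k(α)`. -/
def exponentInf (α : ℕ → ℝ) (k : ℕ) : ℝ := sInf (exponentSet α k)

/-- The open disc `D(r)` with centre `1 / (2r)` and radius `1 / (2r)`. -/
def halfDisc (r : ℝ) : Set ℂ := {z | ‖z - 1 / (2 * (r : ℂ))‖ < 1 / (2 * r)}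

/-- `Σ = {1, 1/2, 1/3, …}`. -/
def recipSet : Set ℂ := Set.range fun m : ℕ => 1 / ((m : ℂ) + 1)

end

/-! Everything rests on solving `l x - C x = y` for sequences. With `z = l⁻¹`, `c_n = ∏_{i ≤ n} (1 -
z / i)` and `s_n` the sum of the first `n` entries of `x`, the equation telescopes to `c_{n+1}
s_{n+1} - c_n s_n = z c_n y_n` (`cesaroDual_mul_sum`), so `x` is explicit when no `c_n` vanishes.
Euler's limit for the Gamma function shows that `|c_n|` then behaves like `n ^ (-Re z)`, and the
circle `|l - 1/2| = 1/2` without `0` is the line `Re z = 1`.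

Outside the closed disc, `Re z < 1`: the solution is dominated by a power mean, which is bounded on
`c_0(w)` for every decreasing `w`, with a constant independent of `w`. So `l` is a regular point on
each step and on the intersection, and a perturbation of the estimate gives equicontinuity near `l`
(`mem_resolventSetStar_cesaro`).

Inside the open disc, `Re z > 1`. The hypothesis forces `e^{α_n}` to grow at most polynomially,
hence `e^{α_n / k} ≤ B n^{s / k}`, and elements of `Λ_0(α)` grow slower than any positive power of
`n`. A preimage of the first unit vector would make `c_n s_n` a nonzero constant, although it tends
to `0` (`mem_spectrum_cesaroPower`). The same growth bound yields `s_0(k) → 1` and excludes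
nuclearity. Apart from the point `1`, the circle needs no decision: only closures involve it. -/

/-! ### The products `∏ (1 - z / i)` and their growth -/

/-- The sequence `∏_{i=1}^{n} (1 - z / i)`: up to scaling, the eigenvector of the transpose of the
Cesàro operator for the eigenvalue `z⁻¹`. -/
noncomputable def cesaroDual (z : ℂ) (n : ℕ) : ℂ := ∏ i ∈ Finset.range n, (1 - z / ((i : ℂ) + 1))

@[simp] theorem cesaroDual_zero (z : ℂ) : cesaroDual z 0 = 1 := by simp [cesaroDual]

theorem cesaroDual_succ (z : ℂ) (n : ℕ) :
    cesaroDual z (n + 1) = cesaroDual z n * (1 - z / ((n : ℂ) + 1)) := by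
  simp [cesaroDual, Finset.prod_range_succ]

theorem one_sub_div_ne_zero {z : ℂ} (hz : ∀ m : ℕ, z ≠ m + 1) (n : ℕ) :
    1 - z / ((n : ℂ) + 1) ≠ 0 := by
  intro h
  rw [sub_eq_zero, eq_div_iff (Nat.cast_add_one_ne_zero (R := ℂ) n), one_mul] at h
  exact hz n h.symm

theorem cesaroDual_ne_zero {z : ℂ} (hz : ∀ m : ℕ, z ≠ m + 1) (n : ℕ) : cesaroDual z n ≠ 0 :=
  Finset.prod_ne_zero_iff.2 fun i _ => one_sub_div_ne_zero hz i

theorem cesaroDual_eq_zero {m n : ℕ} (h : m < n) : cesaroDual ((m : ℂ) + 1) n = 0 :=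
  Finset.prod_eq_zero (Finset.mem_range.2 h)
    (by rw [div_self (Nat.cast_add_one_ne_zero (R := ℂ) m), sub_self])

/-- This product is the denominator of `Complex.GammaSeq (-z) n`; the identity links `cesaroDual` to
Euler's limit. -/
theorem prod_range_sub_eq (z : ℂ) (n : ℕ) :
    ∏ j ∈ Finset.range (n + 1), (-z + (j : ℂ)) = -z * ((n.factorial : ℂ) * cesaroDual z n) := by
  induction n with
  | zero => simp
  | succ n ih =>
    rw [Finset.prod_range_succ, ih, cesaroDual_succ, Nat.factorial_succ]
    have := Nat.cast_add_one_ne_zero (R := ℂ) n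
    push_cast
    field_simp
    ring

/-- `‖∏_{i=1}^{n} (1 - z / i)‖` decays exactly like `n ^ (-Re z)`. -/
theorem tendsto_rpow_mul_norm_cesaroDual {z : ℂ} (hz0 : z ≠ 0) (hz : ∀ m : ℕ, z ≠ m + 1) :
    ∃ l : ℝ, 0 < l ∧
      Tendsto (fun n : ℕ => (n : ℝ) ^ z.re * ‖cesaroDual z n‖) atTop (𝓝 l) := by
  have hΓ : Complex.Gamma (-z) ≠ 0 := by
    refine Complex.Gamma_ne_zero fun m h => ?_
    rw [neg_inj] at h
    rcases m with _ | m
    · exact hz0 (by simpa using h)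
    · exact hz m (by simpa using h)
  -- The norm of `GammaSeq (-z) n` is `n ^ (-Re z) / (‖z‖ ‖cesaroDual z n‖)`, so the limit sought is
  -- `1 / (‖z‖ ‖Γ(-z)‖)`.
  have h1 := ((Complex.GammaSeq_tendsto_Gamma (-z)).norm.inv₀ (norm_ne_zero_iff.2 hΓ)).mul_const
    (‖z‖⁻¹)
  have hz0' := norm_pos_iff.2 hz0
  have hΓ' := norm_pos_iff.2 hΓ
  refine ⟨_, by positivity, h1.congr' ?_⟩
  filter_upwards [eventually_gt_atTop 0] with n hn
  have hn' : (0 : ℝ) < n := Nat.cast_pos.2 hn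
  have hf : (n.factorial : ℝ) ≠ 0 := Nat.cast_ne_zero.2 n.factorial_ne_zero
  rw [Complex.GammaSeq, prod_range_sub_eq, norm_div, norm_mul, norm_mul, norm_mul, norm_neg,
    Complex.norm_natCast_cpow_of_pos hn, Complex.norm_natCast, Complex.neg_re,
    Real.rpow_neg hn'.le]
  have := (Real.rpow_pos_of_pos hn' z.re).ne'
  field_simp

theorem tendsto_one_sub_div (z : ℂ) :
    Tendsto (fun n : ℕ => ‖1 - z / ((n : ℂ) + 1)‖) atTop (𝓝 1) := by
  have h : Tendsto (fun n : ℕ => z / ((n : ℂ) + 1)) atTop (𝓝 0) := by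
    have := (tendsto_one_div_add_atTop_nhds_zero_nat (𝕜 := ℂ)).const_mul z
    simpa [div_eq_mul_inv] using this
  simpa using (h.const_sub 1).norm

/-- The upper bound survives at positive integers `z`, where the product is eventually zero; this
covers the eigenvalue candidates `1 / m` inside the disc. -/
theorem exists_norm_cesaroDual_le {z : ℂ} (hz0 : z ≠ 0) :
    ∃ K : ℝ, 0 ≤ K ∧ ∀ n : ℕ, ((n : ℝ) + 1) ^ z.re * ‖cesaroDual z (n + 1)‖ ≤ K := by
  have h : ∃ l : ℝ, Tendsto (fun n : ℕ => ((n + 1 : ℕ) : ℝ) ^ z.re * ‖cesaroDual z (n + 1)‖)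
      atTop (𝓝 l) := by
    by_cases hz : ∀ m : ℕ, z ≠ m + 1
    · obtain ⟨l, -, hl⟩ := tendsto_rpow_mul_norm_cesaroDual hz0 hz
      exact ⟨l, hl.comp (tendsto_add_atTop_nat 1)⟩
    · push Not at hz
      obtain ⟨m, rfl⟩ := hz
      refine ⟨0, tendsto_const_nhds.congr' ?_⟩
      filter_upwards [eventually_ge_atTop m] with n hn
      rw [cesaroDual_eq_zero (Nat.lt_succ_of_le hn), norm_zero, mul_zero]
  obtain ⟨l, hl⟩ := h
  obtain ⟨K, hK⟩ := hl.bddAbove_range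
  have hK' : ∀ n : ℕ, ((n : ℝ) + 1) ^ z.re * ‖cesaroDual z (n + 1)‖ ≤ K := fun n => by
    have := hK ⟨n, rfl⟩
    push_cast at this
    exact this
  exact ⟨K, le_trans (by positivity) (hK' 0), hK'⟩

theorem exists_norm_cesaroDual_le_inv {z : ℂ} (hz0 : z ≠ 0) (hz : ∀ m : ℕ, z ≠ m + 1) :
    ∃ K : ℝ, 0 ≤ K ∧ (∀ n : ℕ, ‖cesaroDual z n‖ ≤ K * ((n : ℝ) + 1) ^ (-z.re)) ∧
      ∀ n : ℕ, ‖cesaroDual z (n + 1)‖⁻¹ ≤ K * ((n : ℝ) + 1) ^ z.re := by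
  obtain ⟨l, hl0, hl⟩ := tendsto_rpow_mul_norm_cesaroDual hz0 hz
  have h1 := hl.comp (tendsto_add_atTop_nat 1)
  -- Dividing the bound at `n + 1` by its last factor, which tends to `1`, gives the bound at `n` in
  -- powers of `n + 1`, valid also at `n = 0`.
  obtain ⟨K₁, hK₁⟩ := (h1.div (tendsto_one_sub_div z) one_ne_zero).bddAbove_range
  obtain ⟨K₂, hK₂⟩ := (h1.inv₀ hl0.ne').bddAbove_range
  refine ⟨max K₁ (max K₂ 0), by simp, fun n => ?_, fun n => ?_⟩
  · refine le_trans ?_ (mul_le_mul_of_nonneg_right (le_max_left _ _) (by positivity))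
    have h := hK₁ ⟨n, rfl⟩
    have hp : (0 : ℝ) < ((n : ℝ) + 1) ^ z.re := by positivity
    have h3 := norm_ne_zero_iff.2 (one_sub_div_ne_zero hz n)
    simp only [Function.comp_apply, cesaroDual_succ, norm_mul, Nat.cast_add, Nat.cast_one,
      Pi.div_apply] at h
    rw [← mul_assoc, mul_div_cancel_right₀ _ h3] at h
    rw [Real.rpow_neg (by positivity), ← div_eq_mul_inv, le_div_iff₀ hp]
    linarith
  · refine le_trans ?_ (mul_le_mul_of_nonneg_right ((le_max_left _ _).trans (le_max_right _ _))
      (by positivity))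
    have h := hK₂ ⟨n, rfl⟩
    have hp : (0 : ℝ) < ((n : ℝ) + 1) ^ z.re := by positivity
    simp only [Function.comp_apply, Nat.cast_add, Nat.cast_one, mul_inv] at h
    rw [inv_mul_le_iff₀ hp] at h
    linarith

/-! ### The equation `l x - C x = y` for sequences -/

/-- Multiplying the `n`-th equation by `cesaroDual l⁻¹ n` turns it into a difference of consecutive
left-hand sides, since `l⁻¹ (l x_n - s_{n+1} / (n+1)) = (1 - l⁻¹ / (n+1)) s_{n+1} - s_n`. -/
theorem cesaroDual_mul_sum {l : ℂ} (hl : l ≠ 0) (x : ℕ → ℂ) (n : ℕ) :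
    cesaroDual l⁻¹ n * ∑ i ∈ Finset.range n, x i =
      l⁻¹ * ∑ m ∈ Finset.range n, cesaroDual l⁻¹ m * (l * x m - cesaroSeq x m) := by
  induction n with
  | zero => simp
  | succ n ih =>
    rw [Finset.sum_range_succ (fun m => cesaroDual l⁻¹ m * _), mul_add, ← ih, cesaroDual_succ]
    change _ = _ + l⁻¹ * (_ * (_ - (∑ i ∈ Finset.range (n + 1), x i) / ((n : ℂ) + 1)))
    rw [Finset.sum_range_succ x]
    have := Nat.cast_add_one_ne_zero (R := ℂ) n
    field_simp
    ring

theorem eq_zero_of_smul_sub_cesaroSeq {l : ℂ} (hl : l ≠ 0) (hl' : ∀ m : ℕ, l⁻¹ ≠ m + 1)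
    {x : ℕ → ℂ} (h : ∀ n, l * x n - cesaroSeq x n = 0) : x = 0 := by
  have h1 : ∀ n, ∑ i ∈ Finset.range n, x i = 0 := fun n => by
    have := cesaroDual_mul_sum hl x n
    simpa [h, cesaroDual_ne_zero hl'] using this
  funext n
  have := h1 (n + 1)
  rwa [Finset.sum_range_succ, h1 n, zero_add] at this

/-- The solution `x` of `l x - C x = y`. -/
noncomputable def cesaroResolventSeq (l : ℂ) (y : ℕ → ℂ) (n : ℕ) : ℂ :=
  l⁻¹ * y n + l⁻¹ ^ 2 / (((n : ℂ) + 1) * cesaroDual l⁻¹ (n + 1)) *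
    ∑ m ∈ Finset.range (n + 1), cesaroDual l⁻¹ m * y m

theorem sum_cesaroResolventSeq {l : ℂ} (hl' : ∀ m : ℕ, l⁻¹ ≠ m + 1)
    (y : ℕ → ℂ) (n : ℕ) :
    ∑ i ∈ Finset.range n, cesaroResolventSeq l y i =
      l⁻¹ / cesaroDual l⁻¹ n * ∑ m ∈ Finset.range n, cesaroDual l⁻¹ m * y m := by
  induction n with
  | zero => simp
  | succ n ih =>
    rw [Finset.sum_range_succ, ih, cesaroResolventSeq, Finset.sum_range_succ, cesaroDual_succ]
    have h1 := Nat.cast_add_one_ne_zero (R := ℂ) n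
    have h2 := cesaroDual_ne_zero hl' n
    have h3 : (n : ℂ) + 1 - l⁻¹ ≠ 0 := fun h => hl' n (sub_eq_zero.1 h).symm
    have h4 : 1 - l⁻¹ / ((n : ℂ) + 1) = ((n : ℂ) + 1 - l⁻¹) / ((n : ℂ) + 1) := by field_simp
    rw [h4]
    generalize l⁻¹ = z at *
    field_simp
    ring

theorem smul_sub_cesaroSeq_cesaroResolventSeq {l : ℂ} (hl : l ≠ 0) (hl' : ∀ m : ℕ, l⁻¹ ≠ m + 1)
    (y : ℕ → ℂ) (n : ℕ) :
    l * cesaroResolventSeq l y n - cesaroSeq (cesaroResolventSeq l y) n = y n := by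
  change _ - (∑ i ∈ Finset.range (n + 1), cesaroResolventSeq l y i) / ((n : ℂ) + 1) = _
  rw [sum_cesaroResolventSeq hl', cesaroResolventSeq]
  have h1 := Nat.cast_add_one_ne_zero (R := ℂ) n
  have h2 := cesaroDual_ne_zero hl' (n + 1)
  field_simp
  ring

/-! ### Power means -/

/-- Bernoulli's inequality for the concave power `1 - a`, at `1 - 1 / (n+1)`. It makes the sums of
`(m+1) ^ (-a)` telescope. -/
theorem rpow_neg_le_sub {a : ℝ} (ha0 : 0 ≤ a) (ha : a < 1) (n : ℕ) :
    (1 - a) * ((n : ℝ) + 1) ^ (-a) ≤ ((n : ℝ) + 1) ^ (1 - a) - (n : ℝ) ^ (1 - a) := by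
  have hn : (0 : ℝ) < (n : ℝ) + 1 := by positivity
  have h := rpow_one_add_le_one_add_mul_self (s := -((n : ℝ) + 1)⁻¹) (p := 1 - a)
    (by rw [neg_le_neg_iff]; exact inv_le_one_of_one_le₀ (by linarith [n.cast_nonneg (α := ℝ)]))
    (by linarith) (by linarith)
  have h1 : (1 : ℝ) + -((n : ℝ) + 1)⁻¹ = n / ((n : ℝ) + 1) := by field_simp; ring
  rw [h1, Real.div_rpow n.cast_nonneg hn.le, div_le_iff₀ (by positivity)] at h
  have h2 : ((n : ℝ) + 1) ^ (1 - a) = ((n : ℝ) + 1) * ((n : ℝ) + 1) ^ (-a) := by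
    rw [sub_eq_add_neg, Real.rpow_add hn, Real.rpow_one]
  have h3 : (1 + (1 - a) * -((n : ℝ) + 1)⁻¹) * ((n : ℝ) + 1) ^ (1 - a) =
      ((n : ℝ) + 1) ^ (1 - a) - (1 - a) * ((n : ℝ) + 1) ^ (-a) := by
    rw [h2]; field_simp; ring
  linarith

theorem sum_rpow_neg_le {a : ℝ} (ha0 : 0 ≤ a) (ha : a < 1) (n : ℕ) :
    (1 - a) * ∑ m ∈ Finset.range n, ((m : ℝ) + 1) ^ (-a) ≤ (n : ℝ) ^ (1 - a) := by
  induction n with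
  | zero => simp [Real.zero_rpow (sub_pos.2 ha).ne']
  | succ n ih =>
    rw [Finset.sum_range_succ, mul_add]
    push_cast
    linarith [rpow_neg_le_sub ha0 ha n]

/-- The power mean `(n+1)^(a-1) ∑_{m ≤ n} (m+1)^(-a) g_m`. -/
noncomputable def powerMean (a : ℝ) (g : ℕ → ℝ) (n : ℕ) : ℝ :=
  ((n : ℝ) + 1) ^ (a - 1) * ∑ m ∈ Finset.range (n + 1), ((m : ℝ) + 1) ^ (-a) * g m

theorem powerMean_one_le {a : ℝ} (ha0 : 0 ≤ a) (ha : a < 1) (n : ℕ) :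
    ((n : ℝ) + 1) ^ (a - 1) * ∑ m ∈ Finset.range (n + 1), ((m : ℝ) + 1) ^ (-a) ≤ (1 - a)⁻¹ := by
  have h := sum_rpow_neg_le ha0 ha (n + 1)
  push_cast at h
  rw [← neg_sub 1 a, Real.rpow_neg (by positivity), inv_mul_le_iff₀ (by positivity),
    ← div_eq_mul_inv, le_div_iff₀ (sub_pos.2 ha)]
  linarith

theorem powerMean_le {a : ℝ} (ha0 : 0 ≤ a) (ha : a < 1) {g : ℕ → ℝ} {B : ℝ} (hB : 0 ≤ B)
    (hg : ∀ n, g n ≤ B) (n : ℕ) : powerMean a g n ≤ (1 - a)⁻¹ * B := by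
  refine le_trans ?_ (mul_le_mul_of_nonneg_right (powerMean_one_le ha0 ha n) hB)
  rw [mul_assoc, Finset.sum_mul]
  exact mul_le_mul_of_nonneg_left (Finset.sum_le_sum fun m _ =>
    mul_le_mul_of_nonneg_left (hg m) (by positivity)) (by positivity)

/-- As `a < 1`, the weights `(m+1) ^ (-a)` have divergent sum, so a null sequence averaged against
them is negligible relative to that sum. -/
theorem tendsto_powerMean {a : ℝ} (ha0 : 0 ≤ a) (ha : a < 1) {g : ℕ → ℝ}
    (hg : Tendsto g atTop (𝓝 0)) : Tendsto (powerMean a g) atTop (𝓝 0) := by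
  have ho : (fun m : ℕ => ((m : ℝ) + 1) ^ (-a) * g m) =o[atTop]
      fun m : ℕ => ((m : ℝ) + 1) ^ (-a) := by
    have := (Asymptotics.isBigO_refl (fun m : ℕ => ((m : ℝ) + 1) ^ (-a)) atTop).mul_isLittleO
      ((Asymptotics.isLittleO_one_iff ℝ).2 hg)
    simpa using this
  have hinf : Tendsto (fun n => ∑ m ∈ Finset.range n, ((m : ℝ) + 1) ^ (-a)) atTop atTop := by
    have h1 : ∀ n : ℕ, (n : ℝ) ^ (1 - a) ≤ ∑ m ∈ Finset.range n, ((m : ℝ) + 1) ^ (-a) := by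
      intro n
      rcases n.eq_zero_or_pos with rfl | hn
      · simp [Real.zero_rpow (sub_pos.2 ha).ne']
      have hn' : (0 : ℝ) < n := Nat.cast_pos.2 hn
      have h2 : ∑ m ∈ Finset.range n, (n : ℝ) ^ (-a) = (n : ℝ) ^ (1 - a) := by
        rw [Finset.sum_const, Finset.card_range, nsmul_eq_mul, sub_eq_add_neg,
          Real.rpow_add hn', Real.rpow_one]
      rw [← h2]
      refine Finset.sum_le_sum fun m hm => ?_
      exact Real.rpow_le_rpow_of_nonpos (by positivity)
        (by exact_mod_cast Finset.mem_range.1 hm) (by linarith)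
    exact tendsto_atTop_mono h1 ((tendsto_rpow_atTop (sub_pos.2 ha)).comp
      tendsto_natCast_atTop_atTop)
  have h := (ho.sum_range (fun n => by positivity) hinf).comp_tendsto (tendsto_add_atTop_nat 1)
  have h2 : (powerMean a g) =o[atTop] fun n : ℕ => ((n : ℝ) + 1) ^ (a - 1) *
      ∑ m ∈ Finset.range (n + 1), ((m : ℝ) + 1) ^ (-a) :=
    (Asymptotics.isBigO_refl _ _).mul_isLittleO h
  refine (Asymptotics.isLittleO_one_iff ℝ).1 (h2.trans_isBigO ?_)
  refine Asymptotics.IsBigO.of_bound (1 - a)⁻¹ (Eventually.of_forall fun n => ?_)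
  rw [Real.norm_of_nonneg (by positivity), norm_one, mul_one]
  exact powerMean_one_le ha0 ha n

/-- Domination of the resolvent of the Cesàro operator by a power mean. -/
theorem exists_weight_mul_norm_cesaroResolventSeq_le {l : ℂ} (hl : l ≠ 0) (hre : (l⁻¹).re < 1) :
    ∃ M a : ℝ, 0 ≤ M ∧ 0 ≤ a ∧ a < 1 ∧ ∀ w : ℕ → ℝ≥0, Antitone w → ∀ (y : ℕ → ℂ) (n : ℕ),
      (w n : ℝ) * ‖cesaroResolventSeq l y n‖ ≤
        M * ((w n : ℝ) * ‖y n‖ + powerMean a (fun m => (w m : ℝ) * ‖y m‖) n) := by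
  have hl' : ∀ m : ℕ, l⁻¹ ≠ m + 1 := fun m h => by
    rw [h] at hre
    simp at hre
    linarith [m.cast_nonneg (α := ℝ)]
  obtain ⟨K, hK0, hK1, hK2⟩ := exists_norm_cesaroDual_le_inv (inv_ne_zero hl) hl'
  generalize hz : l⁻¹ = z at *
  -- The power mean bounds need a nonnegative exponent. Raising `Re z` to `a` is harmless because it
  -- is applied to `(n+1) / (m+1) ≥ 1`.
  set a := max z.re 0 with ha
  refine ⟨max ‖z‖ (‖z‖ ^ 2 * (K * K)), a, by positivity, le_max_right _ _, max_lt hre one_pos,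
    fun w hw y n => ?_⟩
  have hn : (0 : ℝ) < (n : ℝ) + 1 := by positivity
  have key : ∀ m ∈ Finset.range (n + 1), (w n : ℝ) * (‖cesaroDual z (n + 1)‖⁻¹ *
      ‖cesaroDual z m * y m‖) ≤ K * K * ((n : ℝ) + 1) ^ a *
        (((m : ℝ) + 1) ^ (-a) * ((w m : ℝ) * ‖y m‖)) := by
    intro m hm
    have hmn : m ≤ n := Nat.lt_succ_iff.1 (Finset.mem_range.1 hm)
    have hm0 : (0 : ℝ) < (m : ℝ) + 1 := by positivity
    have h1 : ((n : ℝ) + 1) ^ z.re * ((m : ℝ) + 1) ^ (-z.re) ≤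
        ((n : ℝ) + 1) ^ a * ((m : ℝ) + 1) ^ (-a) := by
      rw [Real.rpow_neg hm0.le, Real.rpow_neg hm0.le, ← div_eq_mul_inv, ← div_eq_mul_inv,
        ← Real.div_rpow hn.le hm0.le, ← Real.div_rpow hn.le hm0.le]
      refine Real.rpow_le_rpow_of_exponent_le ?_ (le_max_left _ _)
      rw [one_le_div hm0]
      exact_mod_cast Nat.succ_le_succ hmn
    have h2 : ‖cesaroDual z (n + 1)‖⁻¹ * ‖cesaroDual z m‖ ≤
        K * K * (((n : ℝ) + 1) ^ a * ((m : ℝ) + 1) ^ (-a)) :=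
      calc _ ≤ (K * ((n : ℝ) + 1) ^ z.re) * (K * ((m : ℝ) + 1) ^ (-z.re)) :=
            mul_le_mul (hK2 n) (hK1 m) (norm_nonneg _) (by positivity)
        _ = K * K * (((n : ℝ) + 1) ^ z.re * ((m : ℝ) + 1) ^ (-z.re)) := by ring
        _ ≤ _ := mul_le_mul_of_nonneg_left h1 (by positivity)
    -- Only monotonicity of the weight enters, so `M` and `a` depend on `l` alone.
    have h3 : (w n : ℝ) ≤ w m := NNReal.coe_le_coe.2 (hw hmn)
    rw [norm_mul]
    calc _ = (‖cesaroDual z (n + 1)‖⁻¹ * ‖cesaroDual z m‖) * ((w n : ℝ) * ‖y m‖) := by ring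
      _ ≤ (K * K * (((n : ℝ) + 1) ^ a * ((m : ℝ) + 1) ^ (-a))) * ((w m : ℝ) * ‖y m‖) :=
          mul_le_mul h2 (mul_le_mul_of_nonneg_right h3 (norm_nonneg _)) (by positivity)
            (by positivity)
      _ = _ := by ring
  have h4 : ‖(n : ℂ) + 1‖ = (n : ℝ) + 1 := by exact_mod_cast Complex.norm_natCast (n + 1)
  have h5 : (w n : ℝ) * (‖cesaroDual z (n + 1)‖⁻¹ *
      ‖∑ m ∈ Finset.range (n + 1), cesaroDual z m * y m‖) ≤ K * K * ((n : ℝ) + 1) ^ a *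
        ∑ m ∈ Finset.range (n + 1), (((m : ℝ) + 1) ^ (-a) * ((w m : ℝ) * ‖y m‖)) := by
    rw [Finset.mul_sum]
    refine le_trans ?_ (Finset.sum_le_sum key)
    rw [← Finset.mul_sum, ← Finset.mul_sum]
    gcongr
    exact norm_sum_le _ _
  have h6 : ((n : ℝ) + 1) ^ (a - 1) = ((n : ℝ) + 1) ^ a * ((n : ℝ) + 1)⁻¹ := by
    rw [sub_eq_add_neg, Real.rpow_add hn, Real.rpow_neg_one]
  have h7 : (w n : ℝ) * ‖z ^ 2 / (((n : ℂ) + 1) * cesaroDual z (n + 1)) *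
      ∑ m ∈ Finset.range (n + 1), cesaroDual z m * y m‖ ≤
        ‖z‖ ^ 2 * (K * K) * powerMean a (fun m => (w m : ℝ) * ‖y m‖) n := by
    rw [norm_mul, norm_div, norm_mul, norm_pow, h4, powerMean, h6]
    calc _ = ‖z‖ ^ 2 * ((n : ℝ) + 1)⁻¹ * ((w n : ℝ) * (‖cesaroDual z (n + 1)‖⁻¹ *
      ‖∑ m ∈ Finset.range (n + 1), cesaroDual z m * y m‖)) := by
          rw [div_eq_mul_inv, mul_inv]; ring
      _ ≤ _ := mul_le_mul_of_nonneg_left h5 (by positivity)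
      _ = _ := by ring
  have h8 : 0 ≤ powerMean a (fun m => (w m : ℝ) * ‖y m‖) n := by
    unfold powerMean; positivity
  rw [cesaroResolventSeq, hz]
  calc _ ≤ (w n : ℝ) * (‖z * y n‖ + ‖z ^ 2 / (((n : ℂ) + 1) * cesaroDual z (n + 1)) *
      ∑ m ∈ Finset.range (n + 1), cesaroDual z m * y m‖) :=
        mul_le_mul_of_nonneg_left (norm_add_le _ _) (w n).2
    _ ≤ ‖z‖ * ((w n : ℝ) * ‖y n‖) +
        ‖z‖ ^ 2 * (K * K) * powerMean a (fun m => (w m : ℝ) * ‖y m‖) n := by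
        rw [mul_add, norm_mul]; linarith
    _ ≤ _ := by
        rw [mul_add]
        gcongr
        · exact le_max_left _ _
        · exact le_max_right _ _

/-! ### Resolvents of the Cesàro operator on echelon spaces -/

namespace KotheZero

variable {ι : Type*} {a : ι → ℕ → ℝ≥0}

theorem ext_seq {x y : KotheZero a} (h : x.seq = y.seq) : x = y := Subtype.ext h

theorem weight_mul_norm_seq_le (k : ι) (x : KotheZero a) (n : ℕ) :
    (a k n : ℝ) * ‖x.seq n‖ ≤ canonicalSeminorm a k x := le_ciSup (x.bddAbove_seq k) n

theorem canonicalSeminorm_le {k : ι} {x : KotheZero a} {B : ℝ}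
    (h : ∀ n, (a k n : ℝ) * ‖x.seq n‖ ≤ B) : canonicalSeminorm a k x ≤ B := ciSup_le h

theorem seq_sub (x y : KotheZero a) (n : ℕ) : (x - y).seq n = x.seq n - y.seq n := rfl

/-- The element of the space with a given underlying sequence. -/
def ofSeq (y : ℕ → ℂ) (hy : y ∈ kotheSubmodule a) : KotheZero a :=
  (⟨y, hy⟩ : ↥(kotheSubmodule a))

@[simp] theorem seq_ofSeq (y : ℕ → ℂ) (hy : y ∈ kotheSubmodule a) : (ofSeq y hy).seq = y := rfl

/-- The underlying sequence as a linear map. -/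
def seqLinear (a : ι → ℕ → ℝ≥0) : KotheZero a →ₗ[ℂ] ℕ → ℂ where
  toFun := seq
  map_add' _ _ := rfl
  map_smul' _ _ := rfl

theorem seq_sum {κ : Type*} (s : Finset κ) (x : κ → KotheZero a) (n : ℕ) :
    (∑ j ∈ s, x j).seq n = ∑ j ∈ s, (x j).seq n := by
  change seqLinear a (∑ j ∈ s, x j) n = _
  rw [map_sum, Finset.sum_apply]
  rfl

theorem single_mem (n : ℕ) : (Pi.single n 1 : ℕ → ℂ) ∈ kotheSubmodule a := fun k => by
  refine tendsto_const_nhds.congr' ?_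
  filter_upwards [eventually_gt_atTop n] with m hm
  rw [Pi.single_eq_of_ne hm.ne', norm_zero, mul_zero]

/-- The unit vectors. -/
def unitVec (a : ι → ℕ → ℝ≥0) (n : ℕ) : KotheZero a := ofSeq (Pi.single n 1) (single_mem n)

theorem seq_unitVec (n m : ℕ) : (unitVec a n).seq m = if m = n then 1 else 0 := by
  simp [unitVec, Pi.single_apply]

section Cesaro

variable [Nonempty ι]

theorem seq_algebraMap_sub (l : ℂ) (T : KotheZero a →L[ℂ] KotheZero a) (x : KotheZero a) (n : ℕ) :
    ((algebraMap ℂ (KotheZero a →L[ℂ] KotheZero a) l - T) x).seq n =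
      l * x.seq n - (T x).seq n := by
  rw [Algebra.algebraMap_eq_smul_one]
  rfl

/-- Off the closed disc with diameter `[0, 1]`, the equation `l x - C x = y` is solvable with
bounds that do not depend on the weights. -/
theorem exists_cesaro_solution {l : ℂ} (hl : l ≠ 0) (hre : (l⁻¹).re < 1) :
    ∃ M : ℝ, 0 ≤ M ∧ ∀ {ι : Type} [Nonempty ι] {a : ι → ℕ → ℝ≥0} (_ : ∀ k, Antitone (a k))
      (y : KotheZero a), ∃ h : cesaroResolventSeq l y.seq ∈ kotheSubmodule a,
        ∀ k, canonicalSeminorm a k (ofSeq _ h) ≤ M * canonicalSeminorm a k y := by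
  obtain ⟨M, b, hM, hb0, hb1, h⟩ := exists_weight_mul_norm_cesaroResolventSeq_le hl hre
  have hb : 0 < 1 - b := sub_pos.2 hb1
  refine ⟨M * (1 + (1 - b)⁻¹), by positivity, fun {ι} _ {a} ha y => ⟨fun k => ?_, fun k => ?_⟩⟩
  · have h1 := ((y.tendsto_seq k).add (tendsto_powerMean hb0 hb1 (y.tendsto_seq k))).const_mul M
    rw [add_zero, mul_zero] at h1
    exact squeeze_zero (fun n => by positivity) (h (a k) (ha k) y.seq) h1
  · refine canonicalSeminorm_le fun n => (h (a k) (ha k) y.seq n).trans ?_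
    rw [mul_assoc, add_mul, one_mul]
    exact mul_le_mul_of_nonneg_left (add_le_add (weight_mul_norm_seq_le k y n)
      (powerMean_le hb0 hb1 (apply_nonneg _ _) (weight_mul_norm_seq_le k y) n)) hM

end Cesaro

/-- The uniform bounds for the resolvent of the Cesàro operator off the closed disc. -/
theorem exists_cesaro_resolvent_bound {l : ℂ} (hl : l ≠ 0) (hre : (l⁻¹).re < 1) :
    ∃ M : ℝ, 0 ≤ M ∧ ∀ {ι : Type} [Nonempty ι] {a : ι → ℕ → ℝ≥0} (ha : ∀ k, Antitone (a k)),
      l ∈ resolventSet ℂ (cesaro a ha) ∧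
      ∀ k (x : KotheZero a), canonicalSeminorm a k x ≤
        M * canonicalSeminorm a k (l • x - cesaro a ha x) := by
  have hl' : ∀ m : ℕ, l⁻¹ ≠ m + 1 := fun m h => by
    rw [h] at hre
    simp at hre
    linarith [m.cast_nonneg (α := ℝ)]
  obtain ⟨M, hM, h⟩ := exists_cesaro_solution hl hre
  refine ⟨M, hM, fun {ι} _ {a} ha => ?_⟩
  choose hmem hle using h ha
  let R₀ := fun y : KotheZero a => ofSeq _ (hmem y)
  let A : KotheZero a →ₗ[ℂ] KotheZero a := (algebraMap ℂ (KotheZero a →L[ℂ] KotheZero a) l -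
    cesaro a ha : KotheZero a →L[ℂ] KotheZero a)
  have hA : ∀ x, A x = l • x - cesaro a ha x := fun x => by
    refine ext_seq (funext fun n => ?_)
    exact seq_algebraMap_sub l (cesaro a ha) x n
  have hAR : ∀ y, A (R₀ y) = y := fun y => by
    refine ext_seq (funext fun n => ?_)
    rw [hA]
    exact smul_sub_cesaroSeq_cesaroResolventSeq hl hl' y.seq n
  have hinj : Function.Injective A := by
    rw [injective_iff_map_eq_zero]
    intro x hx
    refine ext_seq (eq_zero_of_smul_sub_cesaroSeq hl hl' fun n => ?_)
    have := congrArg (fun v : KotheZero a => v.seq n) hx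
    rw [hA] at this
    exact this
  have hRA : ∀ x, R₀ (A x) = x := fun x => hinj (hAR _)
  -- Linearity of the solution map is inherited from its injective left inverse `A`.
  let R : KotheZero a →ₗ[ℂ] KotheZero a :=
    { toFun := R₀
      map_add' := fun x y => hinj (by rw [map_add, hAR, hAR, hAR])
      map_smul' := fun c x => hinj (by rw [map_smul, hAR, hAR]; rfl) }
  have hcont : Continuous R := by
    refine WithSeminorms.continuous_of_isBounded (withSeminorms a) (withSeminorms a) R
      (fun k => ⟨{k}, ⟨M, hM⟩, fun x => ?_⟩)
    rw [Finset.sup_singleton]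
    exact hle x k
  refine ⟨⟨⟨_, ⟨R, hcont⟩, ContinuousLinearMap.ext hAR, ContinuousLinearMap.ext hRA⟩, rfl⟩,
    fun k x => ?_⟩
  have := hle (A x) k
  rw [← hA]
  rwa [show ofSeq _ (hmem (A x)) = x from hRA x] at this

/-- If `z y - C y = x`, then `l y - C y = x + (l - z) y`, so the estimate at `l` gives `p(y) ≤ M
p(x) + M |l - z| p(y)`. For `z` near `l` the last term is absorbed, uniformly in `z` and in the
seminorm. -/
theorem mem_resolventSetStar_cesaro {ι : Type} [Nonempty ι] {a : ι → ℕ → ℝ≥0}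
    (ha : ∀ k, Antitone (a k)) {l : ℂ} {U : Set ℂ} (hU : U ∈ 𝓝 l)
    (h : ∀ z ∈ U, z ≠ 0 ∧ (z⁻¹).re < 1) : l ∈ resolventSetStar (cesaro a ha) := by
  obtain ⟨ε, hε, hεU⟩ := Metric.mem_nhds_iff.1 hU
  obtain ⟨hl, hre⟩ := h l (mem_of_mem_nhds hU)
  obtain ⟨M, hM, hres⟩ := exists_cesaro_resolvent_bound hl hre
  have hρ : ∀ z ∈ U, z ∈ resolventSet ℂ (cesaro a ha) := fun z hz => by
    obtain ⟨N, -, hN⟩ := exists_cesaro_resolvent_bound (h z hz).1 (h z hz).2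
    exact (hN ha).1
  -- This radius ensures `M |l - z| ≤ 1/2`; `M + 1` avoids division by zero.
  have hδ : 0 < min ε (1 / (2 * (M + 1))) := by positivity
  have hbd : ∀ z ∈ Metric.ball l (min ε (1 / (2 * (M + 1)))), ∀ k (x : KotheZero a),
      canonicalSeminorm a k (resolvent (cesaro a ha) z x) ≤ 2 * M * canonicalSeminorm a k x := by
    intro z hz k x
    have hzU : z ∈ U := hεU (Metric.ball_subset_ball (min_le_left _ _) hz)
    have hzl : ‖l - z‖ ≤ 1 / (2 * (M + 1)) := by
      rw [← dist_eq_norm, dist_comm]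
      exact (Metric.mem_ball.1 hz).le.trans (min_le_right _ _)
    set y := resolvent (cesaro a ha) z x with hy
    have h1 : z • y - cesaro a ha y = x := by
      have h2 : (algebraMap ℂ (KotheZero a →L[ℂ] KotheZero a) z - cesaro a ha) *
        resolvent (cesaro a ha) z = 1 := Ring.mul_inverse_cancel _ (hρ z hzU)
      have h3 := congrArg (fun T : KotheZero a →L[ℂ] KotheZero a => T x) h2
      refine Eq.trans ?_ h3
      exact ext_seq (funext fun n => (seq_algebraMap_sub z (cesaro a ha) y n).symm)
    have h4 : l • y - cesaro a ha y = x + (l - z) • y := by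
      rw [← h1, sub_smul]; abel
    have h5 := (hres ha).2 k y
    rw [h4] at h5
    have h6 := (map_add_le_add (canonicalSeminorm a k) x ((l - z) • y))
    rw [map_smul_eq_mul] at h6
    have h7 : 0 ≤ canonicalSeminorm a k y := apply_nonneg _ _
    have h8 : M * ‖l - z‖ ≤ 1 / 2 := by
      calc M * ‖l - z‖ ≤ M * (1 / (2 * (M + 1))) := mul_le_mul_of_nonneg_left hzl hM
        _ ≤ 1 / 2 := by
          rw [mul_one_div, div_le_div_iff₀ (by positivity) (by positivity)]; linarith
    have h9 := mul_le_mul_of_nonneg_right h8 h7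
    have h10 := mul_le_mul_of_nonneg_left h6 hM
    linarith
  refine ⟨_, hδ, fun z hz => hρ z (hεU (Metric.ball_subset_ball (min_le_left _ _) hz)),
    fun W hW => ?_⟩
  obtain ⟨s, r, hr, hs⟩ := ((withSeminorms a).mem_nhds_iff 0 W).1 hW
  have hr' : 0 < r / (2 * M + 1) := by positivity
  refine ⟨_, ((withSeminorms a).mem_nhds_iff 0 _).2 ⟨s, _, hr', subset_rfl⟩,
    fun z hz x hx => hs ?_⟩
  rw [Seminorm.mem_ball_zero] at hx ⊢
  refine Seminorm.finset_sup_apply_lt hr fun k hk => (hbd z hz k x).trans_lt ?_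
  have h1 : canonicalSeminorm a k x < r / (2 * M + 1) :=
    lt_of_le_of_lt (Seminorm.le_finset_sup_apply hk) hx
  rw [lt_div_iff₀ (by positivity)] at h1
  have h7 : 0 ≤ canonicalSeminorm a k x := apply_nonneg _ _
  linarith

/-- If the weights increase with `k` and a point is in the resolvent set of the Cesàro operator on
each step `c_0(a_k)`, then it is in the resolvent set on the intersection. -/
theorem mem_resolventSet_cesaro_of_forall {a : ℕ → ℕ → ℝ≥0} (ha : ∀ k, Antitone (a k))
    (hmono : Monotone a) {l : ℂ} (h : ∀ k, l ∈ resolventSet ℂ (cesaroWeighted (a k) (ha k))) :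
    l ∈ resolventSet ℂ (cesaro a ha) := by
  choose u hu using h
  let incl : ∀ k, KotheZero a →ₗ[ℂ] WeightedC0 (a k) := fun k =>
    { toFun := fun x => ofSeq x.seq fun _ => x.tendsto_seq k
      map_add' := fun _ _ => rfl
      map_smul' := fun _ _ => rfl }
  have hincl : ∀ k, Continuous (incl k) := fun k =>
    WithSeminorms.continuous_of_continuous_comp (withSeminorms _) _ fun _ =>
      (withSeminorms a).continuous_seminorm k
  have hu' : ∀ k (x : WeightedC0 (a k)) (n : ℕ),
      ((u k : WeightedC0 (a k) →L[ℂ] WeightedC0 (a k)) x).seq n =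
        l * x.seq n - cesaroSeq x.seq n := fun k x n => by
    rw [hu]
    exact seq_algebraMap_sub l _ x n
  let V : ∀ k, WeightedC0 (a k) →L[ℂ] WeightedC0 (a k) := fun k => ((u k)⁻¹ : _ˣ)
  have hUV : ∀ k x, (u k : WeightedC0 (a k) →L[ℂ] WeightedC0 (a k)) (V k x) = x := fun k x =>
    congrArg (fun T : WeightedC0 (a k) →L[ℂ] WeightedC0 (a k) => T x) (u k).mul_inv
  have hVU : ∀ k x, V k ((u k : WeightedC0 (a k) →L[ℂ] WeightedC0 (a k)) x) = x := fun k x =>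
    congrArg (fun T : WeightedC0 (a k) →L[ℂ] WeightedC0 (a k) => T x) (u k).inv_mul
  -- Increasing weights embed `c_0(a_k)` into `c_0(a_0)`, and injectivity of `l - C` there forces
  -- all the step resolvents to agree on the intersection.
  have heq : ∀ k (y : KotheZero a), (V 0 (incl 0 y)).seq = (V k (incl k y)).seq := by
    intro k y
    have hmem : (V k (incl k y)).seq ∈ kotheSubmodule fun _ : Unit => a 0 := fun _ =>
      squeeze_zero (fun n => by positivity) (fun n => mul_le_mul_of_nonneg_right
        (NNReal.coe_le_coe.2 (hmono k.zero_le n)) (norm_nonneg _))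
        ((V k (incl k y)).tendsto_seq ())
    have h1 : (u 0 : WeightedC0 (a 0) →L[ℂ] WeightedC0 (a 0)) (ofSeq _ hmem) = incl 0 y := by
      refine ext_seq (funext fun n => ?_)
      rw [hu', seq_ofSeq, ← hu', hUV]
      rfl
    rw [← h1, hVU]
    rfl
  have hmemR : ∀ y : KotheZero a, (V 0 (incl 0 y)).seq ∈ kotheSubmodule a := fun y k => by
    rw [heq k y]
    exact (V k (incl k y)).tendsto_seq ()
  let R : KotheZero a →ₗ[ℂ] KotheZero a :=
    { toFun := fun y => ofSeq _ (hmemR y)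
      map_add' := fun x y => ext_seq (by simp only [map_add]; rfl)
      map_smul' := fun c x => ext_seq (by simp only [map_smul]; rfl) }
  have hR : ∀ k y, incl k (R y) = V k (incl k y) := fun k y => ext_seq (heq k y)
  have hRc : Continuous R := by
    refine WithSeminorms.continuous_of_continuous_comp (withSeminorms a) _ fun k => ?_
    have h1 : Continuous fun y => canonicalSeminorm (fun _ : Unit => a k) () (V k (incl k y)) :=
      ((withSeminorms _).continuous_seminorm ()).comp ((V k).continuous.comp (hincl k))
    refine h1.congr fun y => ?_
    rw [← hR]
    rfl
  refine ⟨⟨_, ⟨R, hRc⟩, ContinuousLinearMap.ext fun y => ?_, ContinuousLinearMap.ext fun x => ?_⟩,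
    rfl⟩
  · refine ext_seq (funext fun n => ?_)
    refine (seq_algebraMap_sub l (cesaro a ha) (R y) n).trans ?_
    have h1 := hu' 0 (V 0 (incl 0 y)) n
    rw [hUV] at h1
    exact h1.symm
  · refine ext_seq ?_
    change (V 0 (incl 0 _)).seq = x.seq
    have h1 : incl 0 ((algebraMap ℂ (KotheZero a →L[ℂ] KotheZero a) l - cesaro a ha) x) =
        (u 0 : WeightedC0 (a 0) →L[ℂ] WeightedC0 (a 0)) (incl 0 x) :=
      ext_seq (funext fun n =>
        (seq_algebraMap_sub l (cesaro a ha) x n).trans (hu' 0 (incl 0 x) n).symm)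
    refine (congrArg (fun v => (V 0 v).seq) h1).trans ?_
    rw [hVU]
    rfl

/-! ### Nuclearity -/

/-- A necessary condition for nuclearity of an echelon space of order `0`. -/
theorem exists_sum_weight_div_le_of_isNuclearSpace {a : ℕ → ℕ → ℝ≥0} (hmono : Monotone a)
    (hpos : ∀ k n, 0 < a k n) (hnuc : IsNuclearSpace (KotheZero a)) (m : ℕ) :
    ∃ k : ℕ, ∃ B : ℝ, ∀ N : ℕ, ∑ n ∈ Finset.range N, (a m n : ℝ) / a k n ≤ B := by
  set p := canonicalSeminorm a m with hp
  obtain ⟨q, hq, f, y, hf, hy, hlim⟩ := hnuc p ((withSeminorms a).continuous_seminorm m)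
  obtain ⟨s, C, -, hC⟩ := Seminorm.bound_of_continuous (withSeminorms a) q hq
  obtain ⟨k, hk⟩ := s.exists_nat_subset_range
  have hq' : ∀ x, q x ≤ C * canonicalSeminorm a k x := fun x => by
    refine (hC x).trans ?_
    rw [smul_apply, NNReal.smul_def, smul_eq_mul]
    refine mul_le_mul_of_nonneg_left ?_ C.2
    refine Seminorm.finset_sup_apply_le (apply_nonneg _ _) fun i hi =>
      canonicalSeminorm_le fun n => le_trans ?_ (weight_mul_norm_seq_le k x n)
    exact mul_le_mul_of_nonneg_right (NNReal.coe_le_coe.2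
      (hmono (Finset.mem_range.1 (hk hi)).le n)) (norm_nonneg _)
  have hk0 : ∀ n, (0 : ℝ) < a k n := fun n => NNReal.coe_pos.2 (hpos k n)
  refine ⟨k, C * ∑' j, p (y j), fun N => ?_⟩
  -- Each `f j` is tested on a finitely supported vector of the unit ball of `p_k`, with phases that
  -- align the summands.
  have hfj : ∀ j, ∑ n ∈ Finset.range N, ‖f j (unitVec a n)‖ / a k n ≤ C := by
    intro j
    have hc : ∀ z : ℂ, ∃ c : ℂ, ‖c‖ ≤ 1 ∧ c * z = (‖z‖ : ℂ) := fun z => by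
      rcases eq_or_ne z 0 with rfl | hz
      · exact ⟨0, by simp, by simp⟩
      · refine ⟨‖z‖ / z, ?_, by field_simp⟩
        rw [norm_div, Complex.norm_real, norm_norm, div_self (norm_ne_zero_iff.2 hz)]
    choose c hc1 hc2 using hc
    let x : KotheZero a := ∑ n ∈ Finset.range N,
      (c (f j (unitVec a n)) / ((a k n : ℝ) : ℂ)) • unitVec a n
    have hx : f j x = ((∑ n ∈ Finset.range N, ‖f j (unitVec a n)‖ / a k n : ℝ) : ℂ) := by
      simp only [x, map_sum, map_smul, smul_eq_mul]
      push_cast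
      exact Finset.sum_congr rfl fun n _ => by rw [div_mul_eq_mul_div, hc2]
    have hpx : canonicalSeminorm a k x ≤ 1 := by
      refine canonicalSeminorm_le fun i => ?_
      simp only [x, seq_sum, seq_smul, seq_unitVec, mul_ite, mul_one, mul_zero,
        Finset.sum_ite_eq]
      split_ifs
      · rw [norm_div, Complex.norm_real, Real.norm_of_nonneg (hk0 i).le, mul_div_cancel₀ _ (hk0 i).ne']
        exact hc1 _
      · simp
    have h1 := (hf j x).trans (hq' x)
    rw [hx, Complex.norm_real, Real.norm_of_nonneg
      (Finset.sum_nonneg fun n _ => div_nonneg (norm_nonneg _) (hk0 n).le)] at h1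
    exact h1.trans (mul_le_of_le_one_right C.2 hpx)
  let ε : ℕ → ℕ → ℝ := fun n J =>
    p (unitVec a n - ∑ j ∈ Finset.range J, f j (unitVec a n) • y j)
  -- The `n`-th coordinate of the expansion of the `n`-th unit vector: a trace estimate, with
  -- remainder `ε n J`.
  have hn : ∀ J n, (a m n : ℝ) ≤ ∑ j ∈ Finset.range J, ‖f j (unitVec a n)‖ * p (y j) + ε n J := by
    intro J n
    have h1 := weight_mul_norm_seq_le m
      (unitVec a n - ∑ j ∈ Finset.range J, f j (unitVec a n) • y j) n
    rw [seq_sub, seq_sum, seq_unitVec, if_pos rfl] at h1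
    have h2 : (a m n : ℝ) * ‖∑ j ∈ Finset.range J, (f j (unitVec a n) • y j).seq n‖ ≤
        ∑ j ∈ Finset.range J, ‖f j (unitVec a n)‖ * p (y j) := by
      refine (mul_le_mul_of_nonneg_left (norm_sum_le _ _) (a m n).2).trans ?_
      rw [Finset.mul_sum]
      refine Finset.sum_le_sum fun j _ => ?_
      rw [seq_smul, norm_mul, mul_left_comm]
      exact mul_le_mul_of_nonneg_left (weight_mul_norm_seq_le m (y j) n) (norm_nonneg _)
    have h3 : (1 : ℝ) ≤ ‖1 - ∑ j ∈ Finset.range J, (f j (unitVec a n) • y j).seq n‖ +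
        ‖∑ j ∈ Finset.range J, (f j (unitVec a n) • y j).seq n‖ := by
      refine le_trans ?_ (norm_add_le _ _)
      rw [sub_add_cancel, norm_one]
    have h4 := mul_le_mul_of_nonneg_left h3 (a m n).2
    rw [mul_one, mul_add] at h4
    change _ ≤ ε n J at h1
    exact h4.trans (by rw [add_comm]; exact add_le_add h2 h1)
  -- With `N` fixed the bound is independent of `J` up to finitely many remainders, which vanish as
  -- `J → ∞`.
  have hJ : ∀ J, ∑ n ∈ Finset.range N, (a m n : ℝ) / a k n ≤
      C * ∑' j, p (y j) + ∑ n ∈ Finset.range N, ε n J / a k n := by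
    intro J
    calc _ ≤ ∑ n ∈ Finset.range N,
          (∑ j ∈ Finset.range J, ‖f j (unitVec a n)‖ * p (y j) + ε n J) / a k n :=
          Finset.sum_le_sum fun n _ => div_le_div_of_nonneg_right (hn J n) (hk0 n).le
      _ = ∑ j ∈ Finset.range J, (∑ n ∈ Finset.range N, ‖f j (unitVec a n)‖ / a k n) * p (y j) +
          ∑ n ∈ Finset.range N, ε n J / a k n := by
          simp only [add_div, Finset.sum_add_distrib, Finset.sum_div, Finset.sum_mul]
          rw [Finset.sum_comm]
          simp only [div_mul_eq_mul_div]
      _ ≤ _ := by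
          gcongr
          calc _ ≤ ∑ j ∈ Finset.range J, (C : ℝ) * p (y j) :=
                Finset.sum_le_sum fun j _ =>
                  mul_le_mul_of_nonneg_right (hfj j) (apply_nonneg _ _)
            _ ≤ _ := by
                rw [← Finset.mul_sum]
                exact mul_le_mul_of_nonneg_left
                  (hy.sum_le_tsum _ fun j _ => apply_nonneg _ _) C.2
  have hε : Tendsto (fun J => ∑ n ∈ Finset.range N, ε n J / a k n) atTop (𝓝 0) := by
    have := tendsto_finsetSum (Finset.range N) fun n _ => (hlim (unitVec a n)).div_const (a k n : ℝ)
    simpa using this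
  have := hε.const_add (C * ∑' j, p (y j))
  rw [add_zero] at this
  exact ge_of_tendsto' this hJ

end KotheZero

/-! ### Discs -/

theorem norm_sub_ofReal_sq (z : ℂ) (c : ℝ) :
    ‖z - (c : ℂ)‖ ^ 2 = Complex.normSq z - 2 * c * z.re + c ^ 2 := by
  rw [← Complex.normSq_eq_norm_sq, Complex.normSq_sub]
  simp [Complex.normSq_ofReal]
  ring

theorem norm_sub_lt_iff {c : ℝ} (hc : 0 ≤ c) (z : ℂ) :
    ‖z - (c : ℂ)‖ < c ↔ Complex.normSq z < 2 * c * z.re := by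
  rw [← pow_lt_pow_iff_left₀ (norm_nonneg _) hc two_ne_zero, norm_sub_ofReal_sq]
  constructor <;> intro h <;> linarith

theorem norm_sub_le_iff {c : ℝ} (hc : 0 ≤ c) (z : ℂ) :
    ‖z - (c : ℂ)‖ ≤ c ↔ Complex.normSq z ≤ 2 * c * z.re := by
  rw [← pow_le_pow_iff_left₀ (norm_nonneg _) hc two_ne_zero, norm_sub_ofReal_sq]
  constructor <;> intro h <;> linarith

theorem norm_sub_half_lt_iff (z : ℂ) : ‖z - 1 / 2‖ < 1 / 2 ↔ Complex.normSq z < z.re := by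
  have := norm_sub_lt_iff (c := 1 / 2) (by norm_num) z
  push_cast at this
  rw [this]
  norm_num

theorem norm_sub_half_le_iff (z : ℂ) : ‖z - 1 / 2‖ ≤ 1 / 2 ↔ Complex.normSq z ≤ z.re := by
  have := norm_sub_le_iff (c := 1 / 2) (by norm_num) z
  push_cast at this
  rw [this]
  norm_num

theorem mem_halfDisc_iff {r : ℝ} (hr : 0 < r) (z : ℂ) :
    z ∈ halfDisc r ↔ r * Complex.normSq z < z.re := by
  have h := norm_sub_lt_iff (c := 1 / (2 * r)) (by positivity) z
  push_cast at h
  change ‖z - 1 / (2 * (r : ℂ))‖ < 1 / (2 * r) ↔ _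
  rw [h, show 2 * (1 / (2 * r)) * z.re = z.re / r by field_simp, lt_div_iff₀ hr, mul_comm]

/-- Inversion carries the open disc to the half-plane `Re > 1`, because `Re z⁻¹ = Re z / |z|²`. -/
theorem ne_zero_and_one_lt_inv_re {z : ℂ} (h : ‖z - 1 / 2‖ < 1 / 2) : z ≠ 0 ∧ 1 < (z⁻¹).re := by
  rw [norm_sub_half_lt_iff] at h
  have hz : z ≠ 0 := by rintro rfl; simp at h
  refine ⟨hz, ?_⟩
  rwa [Complex.inv_re, one_lt_div (Complex.normSq_pos.2 hz)]

theorem ne_zero_and_inv_re_lt_one {z : ℂ} (h : ¬ ‖z - 1 / 2‖ ≤ 1 / 2) :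
    z ≠ 0 ∧ (z⁻¹).re < 1 := by
  rw [norm_sub_half_le_iff, not_le] at h
  have hz : z ≠ 0 := by rintro rfl; simp at h
  refine ⟨hz, ?_⟩
  rwa [Complex.inv_re, div_lt_one (Complex.normSq_pos.2 hz)]

theorem recipSet_subset : recipSet ⊆ {z : ℂ | ‖z - 1 / 2‖ < 1 / 2} ∪ {1} := by
  rintro _ ⟨m, rfl⟩
  rcases m with _ | m
  · right; simp
  · left
    change ‖1 / (((m + 1 : ℕ) : ℂ) + 1) - 1 / 2‖ < (1 / 2 : ℝ)
    have h0 : (0 : ℝ) < ((m : ℝ) + 1) + 1 := by positivity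
    have h1 : (1 : ℂ) / (((m + 1 : ℕ) : ℂ) + 1) = ((1 / (((m : ℝ) + 1) + 1) : ℝ) : ℂ) := by
      push_cast; rfl
    rw [norm_sub_half_lt_iff, h1, Complex.normSq_ofReal, Complex.ofReal_re]
    refine mul_lt_of_lt_one_left (by positivity) ?_
    rw [div_lt_one h0]
    linarith [m.cast_nonneg (α := ℝ)]

/-! ### Growth of the exponents -/

/-- Polynomial growth of `e^{α_n}`. -/
theorem exists_exp_div_le {α : ℕ → ℝ} (hS : (exponentSet α 0).Nonempty) :
    ∃ s B : ℝ, 0 ≤ s ∧ 1 ≤ B ∧ ∀ k n : ℕ,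
      Real.exp (α n / ((k : ℝ) + 1)) ≤ B * ((n : ℝ) + 1) ^ (s / ((k : ℝ) + 1)) := by
  obtain ⟨s, hs⟩ := hS
  -- The terms of a convergent series are bounded; the estimate for `k` is the `(k+1)`-st root of
  -- the one for `0`. Enlarging `B` to at least `1` keeps its roots below `B`.
  obtain ⟨B, hB⟩ := hs.tendsto_atTop_zero.bddAbove_range
  refine ⟨max s 0, max B 1, le_max_right _ _, le_max_right _ _, fun k n => ?_⟩
  have hn : (1 : ℝ) ≤ (n : ℝ) + 1 := by linarith [n.cast_nonneg (α := ℝ)]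
  have hk : (1 : ℝ) ≤ (k : ℝ) + 1 := by linarith [k.cast_nonneg (α := ℝ)]
  have h1 : Real.exp (α n) ≤ max B 1 * ((n : ℝ) + 1) ^ max s 0 := by
    have h2 := hB ⟨n, rfl⟩
    simp only [Nat.cast_zero, zero_add, div_one] at h2
    rw [div_le_iff₀ (by positivity)] at h2
    refine h2.trans (mul_le_mul (le_max_left _ _)
      (Real.rpow_le_rpow_of_exponent_le hn (le_max_left _ _)) (by positivity) (by positivity))
  calc Real.exp (α n / ((k : ℝ) + 1)) = Real.exp (α n) ^ ((k : ℝ) + 1)⁻¹ := by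
        rw [← Real.exp_mul, div_eq_mul_inv]
    _ ≤ (max B 1 * ((n : ℝ) + 1) ^ max s 0) ^ ((k : ℝ) + 1)⁻¹ :=
        Real.rpow_le_rpow (Real.exp_pos _).le h1 (by positivity)
    _ = max B 1 ^ ((k : ℝ) + 1)⁻¹ * ((n : ℝ) + 1) ^ (max s 0 / ((k : ℝ) + 1)) := by
        rw [Real.mul_rpow (by positivity) (by positivity), ← Real.rpow_mul (by positivity),
          div_eq_mul_inv]
    _ ≤ _ := by
        gcongr
        calc max B 1 ^ ((k : ℝ) + 1)⁻¹ ≤ max B 1 ^ (1 : ℝ) :=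
              Real.rpow_le_rpow_of_exponent_le (le_max_right _ _) (inv_le_one_of_one_le₀ hk)
          _ = _ := Real.rpow_one _

theorem summable_rpow_neg_iff (s : ℝ) :
    Summable (fun n : ℕ => 1 / ((n : ℝ) + 1) ^ s) ↔ 1 < s := by
  rw [← Real.summable_one_div_nat_add_rpow 1 s]
  refine summable_congr fun n => ?_
  rw [abs_of_nonneg (by positivity)]

theorem one_lt_of_mem_exponentSet {α : ℕ → ℝ} (hα : ∀ n, 0 ≤ α n) {k : ℕ} {s : ℝ}
    (hs : s ∈ exponentSet α k) : 1 < s := by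
  rw [← summable_rpow_neg_iff]
  refine Summable.of_nonneg_of_le (fun n => by positivity) (fun n => ?_) hs
  refine div_le_div_of_nonneg_right (Real.one_le_exp ?_) (by positivity)
  exact div_nonneg (hα n) (by positivity)

/-- The spare `1 / (k+1)` in the exponent leaves the convergent series of `(n+1) ^ (-1 - 1 /
(k+1))`. These exponents tend to `1`, which makes the discs fill `D(1)`. -/
theorem mem_exponentSet_of_le {α : ℕ → ℝ} {k : ℕ} {s B : ℝ}
    (h : ∀ n : ℕ, Real.exp (α n / ((k : ℝ) + 1)) ≤ B * ((n : ℝ) + 1) ^ (s / ((k : ℝ) + 1))) :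
    1 + (s + 1) / ((k : ℝ) + 1) ∈ exponentSet α k := by
  have h1 : 1 < 1 + 1 / ((k : ℝ) + 1) := by
    have : 0 < 1 / ((k : ℝ) + 1) := by positivity
    linarith
  refine Summable.of_nonneg_of_le (fun n => by positivity) (fun n => ?_)
    (((summable_rpow_neg_iff _).2 h1).mul_left B)
  have hn : (0 : ℝ) < (n : ℝ) + 1 := by positivity
  rw [div_le_iff₀ (by positivity)]
  refine (h n).trans (le_of_eq ?_)
  rw [mul_assoc, one_div, ← Real.rpow_neg hn.le, ← Real.rpow_add hn]
  congr 2
  ring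

theorem exists_nat_mul_inv_lt (c : ℝ) {ε : ℝ} (hε : 0 < ε) : ∃ k : ℕ, c / ((k : ℝ) + 1) < ε := by
  obtain ⟨k, hk⟩ := exists_nat_gt (c / ε)
  refine ⟨k, ?_⟩
  rw [div_lt_iff₀ hε] at hk
  rw [div_lt_iff₀ (by positivity)]
  linarith

/-! ### The spectrum on power series spaces -/

theorem powerWeight_monotone {α : ℕ → ℝ} (hα : ∀ n, 0 ≤ α n) : Monotone (powerWeight α) := by
  intro k l hkl n
  refine NNReal.coe_le_coe.mp (Real.exp_le_exp.mpr (neg_le_neg ?_))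
  have : (k : ℝ) ≤ l := Nat.cast_le.2 hkl
  exact div_le_div_of_nonneg_left (hα n) (by positivity) (by linarith)

theorem norm_seq_le_powerWeight {α : ℕ → ℝ} (k : ℕ) (x : PowerSeriesZero α) (n : ℕ) :
    ‖x.seq n‖ ≤
      KotheZero.canonicalSeminorm (powerWeight α) k x * Real.exp (α n / ((k : ℝ) + 1)) := by
  have h := KotheZero.weight_mul_norm_seq_le k x n
  change Real.exp (-(α n / ((k : ℝ) + 1))) * _ ≤ _ at h
  rw [Real.exp_neg, inv_mul_le_iff₀ (Real.exp_pos _)] at h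
  linarith

theorem mem_spectrum_cesaroPower {α : ℕ → ℝ} (hα : Monotone α)
    (hS : (exponentSet α 0).Nonempty) {l : ℂ} (hl : l ∈ {z : ℂ | ‖z - 1 / 2‖ < 1 / 2} ∪ {1}) :
    l ∈ spectrum ℂ (cesaroPower α hα) := by
  intro hunit
  obtain ⟨u, hu⟩ : IsUnit _ := hunit
  set x := (u⁻¹ : (PowerSeriesZero α →L[ℂ] PowerSeriesZero α)ˣ).1
    (KotheZero.unitVec (powerWeight α) 0) with hx
  have hux : u.1 x = KotheZero.unitVec (powerWeight α) 0 :=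
    congrArg (fun T : PowerSeriesZero α →L[ℂ] PowerSeriesZero α =>
      T (KotheZero.unitVec (powerWeight α) 0)) u.mul_inv
  have hxn : ∀ n, l * x.seq n - cesaroSeq x.seq n = if n = 0 then 1 else 0 := fun n => by
    rw [← KotheZero.seq_unitVec (a := powerWeight α), ← hux, hu]
    exact (KotheZero.seq_algebraMap_sub l (cesaroPower α hα) x n).symm
  have hl0 : l ≠ 0 := by
    rcases hl with hl | rfl
    · exact (ne_zero_and_one_lt_inv_re hl).1
    · exact one_ne_zero
  have hsum : ∀ n : ℕ, cesaroDual l⁻¹ (n + 1) * ∑ i ∈ Finset.range (n + 1), x.seq i = l⁻¹ := by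
    intro n
    rw [cesaroDual_mul_sum hl0]
    simp [hxn]
  rcases hl with hl | rfl
  · obtain ⟨-, hre⟩ := ne_zero_and_one_lt_inv_re hl
    obtain ⟨K, hK0, hK⟩ := exists_norm_cesaroDual_le (inv_ne_zero hl0)
    obtain ⟨s, B, hs, hB, hexp⟩ := exists_exp_div_le hS
    -- With this `k`, `s_n = O(n ^ (1 + s / (k+1)))` loses against `c_n = O(n ^ (-Re l⁻¹))`.
    obtain ⟨k, hk⟩ := exists_nat_mul_inv_lt s (sub_pos.2 hre)
    set P := KotheZero.canonicalSeminorm (powerWeight α) k x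
    have hP : 0 ≤ P := apply_nonneg _ _
    have hbound : ∀ n : ℕ, ‖l⁻¹‖ ≤
        K * P * B * ((n : ℝ) + 1) ^ (-((l⁻¹).re - 1 - s / ((k : ℝ) + 1))) := by
      intro n
      have hn : (0 : ℝ) < (n : ℝ) + 1 := by positivity
      have h1 : ‖∑ i ∈ Finset.range (n + 1), x.seq i‖ ≤
          ((n : ℝ) + 1) * (P * (B * ((n : ℝ) + 1) ^ (s / ((k : ℝ) + 1)))) := by
        refine (norm_sum_le_of_le (f := x.seq)
          (n := fun _ => P * (B * ((n : ℝ) + 1) ^ (s / ((k : ℝ) + 1)))) _ fun i hi => ?_).trans ?_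
        · refine (norm_seq_le_powerWeight k x i).trans (mul_le_mul_of_nonneg_left ?_ hP)
          refine le_trans (Real.exp_le_exp.2 (div_le_div_of_nonneg_right ?_ (by positivity)))
            (hexp k n)
          exact hα (Nat.lt_succ_iff.1 (Finset.mem_range.1 hi))
        · rw [Finset.sum_const, Finset.card_range, nsmul_eq_mul]
          push_cast
          rfl
      have h2 : ‖cesaroDual l⁻¹ (n + 1)‖ ≤ K * ((n : ℝ) + 1) ^ (-(l⁻¹).re) := by
        rw [Real.rpow_neg hn.le, ← div_eq_mul_inv, le_div_iff₀ (by positivity), mul_comm]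
        exact hK n
      rw [show ‖l⁻¹‖ = ‖cesaroDual l⁻¹ (n + 1)‖ * ‖∑ i ∈ Finset.range (n + 1), x.seq i‖ by
        rw [← norm_mul, hsum n]]
      refine (mul_le_mul h2 h1 (norm_nonneg _) (by positivity)).trans (le_of_eq ?_)
      rw [show -((l⁻¹).re - 1 - s / ((k : ℝ) + 1)) = -(l⁻¹).re + 1 + s / ((k : ℝ) + 1) by ring,
        Real.rpow_add hn, Real.rpow_add hn, Real.rpow_one]
      ring
    have hlim : Tendsto (fun n : ℕ => K * P * B *
        ((n : ℝ) + 1) ^ (-((l⁻¹).re - 1 - s / ((k : ℝ) + 1)))) atTop (𝓝 0) := by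
      have h1 := ((tendsto_rpow_neg_atTop (sub_pos.2 hk)).comp
        (tendsto_atTop_add_const_right _ (1 : ℝ) (tendsto_natCast_atTop_atTop (R := ℝ)))).const_mul
        (K * P * B)
      rwa [mul_zero] at h1
    have := ge_of_tendsto' hlim hbound
    exact inv_ne_zero hl0 (norm_le_zero_iff.1 this)
  -- For `l = 1` the first factor `1 - 1` already vanishes, while the product should equal `1`.
  · have h := hsum 0
    simp [cesaroDual] at h

theorem not_isNuclearSpace_powerSeriesZero {α : ℕ → ℝ} (hα : ∀ n, 0 ≤ α n)
    (hS : (exponentSet α 0).Nonempty) : ¬ IsNuclearSpace (PowerSeriesZero α) := by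
  intro hnuc
  obtain ⟨s, B, hs, hB, hexp⟩ := exists_exp_div_le hS
  -- This `m` gives `w_m(n) ≥ 1 / (B (n+1))`. Since every `w_k ≤ 1`, the quotients `w_m / w_k`
  -- dominate a harmonic series.
  obtain ⟨m, hm⟩ := exists_nat_mul_inv_lt s one_pos
  obtain ⟨k, D, hD⟩ := KotheZero.exists_sum_weight_div_le_of_isNuclearSpace
    (powerWeight_monotone hα) (fun k n => Real.exp_pos _) hnuc m
  have h1 : Summable fun n => (powerWeight α m n : ℝ) / powerWeight α k n :=
    summable_of_sum_range_le (fun n => by positivity) hD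
  refine (lt_irrefl (1 : ℝ)) ((summable_rpow_neg_iff 1).1
    (Summable.of_nonneg_of_le (fun n => by positivity) (fun n => ?_) (h1.mul_left B)))
  have hn : (1 : ℝ) ≤ (n : ℝ) + 1 := by linarith [n.cast_nonneg (α := ℝ)]
  have h2 : (powerWeight α m n : ℝ) = (Real.exp (α n / ((m : ℝ) + 1)))⁻¹ := Real.exp_neg _
  have h3 : (powerWeight α k n : ℝ) ≤ 1 :=
    Real.exp_le_one_iff.2 (neg_nonpos.2 (div_nonneg (hα n) (by positivity)))
  have h4 : (0 : ℝ) < powerWeight α k n := Real.exp_pos _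
  have h5 : Real.exp (α n / ((m : ℝ) + 1)) ≤ B * ((n : ℝ) + 1) ^ (1 : ℝ) :=
    (hexp m n).trans (mul_le_mul_of_nonneg_left
      (Real.rpow_le_rpow_of_exponent_le hn hm.le) (by positivity))
  calc 1 / ((n : ℝ) + 1) ^ (1 : ℝ) = B * (B * ((n : ℝ) + 1) ^ (1 : ℝ))⁻¹ := by
        field_simp
    _ ≤ B * (powerWeight α m n : ℝ) := by
        rw [h2]
        exact mul_le_mul_of_nonneg_left (inv_anti₀ (Real.exp_pos _) h5) (by positivity)
    _ ≤ _ := mul_le_mul_of_nonneg_left (le_div_self (powerWeight α m n).2 h4 h3) (by positivity)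

theorem iUnion_halfDisc_union_recipSet {α : ℕ → ℝ} (hα : ∀ n, 0 ≤ α n)
    (hS : (exponentSet α 0).Nonempty) (hinf : ∀ k, 1 ≤ exponentInf α k) :
    {z : ℂ | ‖z - 1 / 2‖ < 1 / 2} ∪ {1} = (⋃ k, halfDisc (exponentInf α k)) ∪ recipSet := by
  obtain ⟨s, B, hs, hB, hexp⟩ := exists_exp_div_le hS
  refine Set.Subset.antisymm (Set.union_subset (fun z hz => ?_) ?_)
    (Set.union_subset (Set.iUnion_subset fun k z hz => ?_) recipSet_subset)
  · obtain ⟨hz0, hre⟩ := ne_zero_and_one_lt_inv_re hz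
    obtain ⟨k, hk⟩ := exists_nat_mul_inv_lt (s + 1) (sub_pos.2 hre)
    have h1 : exponentInf α k ≤ 1 + (s + 1) / ((k : ℝ) + 1) :=
      csInf_le ⟨1, fun t ht => (one_lt_of_mem_exponentSet hα ht).le⟩
        (mem_exponentSet_of_le (hexp k))
    refine Or.inl (Set.mem_iUnion.2 ⟨k, (mem_halfDisc_iff (one_pos.trans_le (hinf k)) z).2 ?_⟩)
    rw [← lt_div_iff₀ (Complex.normSq_pos.2 hz0), ← Complex.inv_re]
    linarith
  · rintro _ rfl
    exact Or.inr ⟨0, by simp⟩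
  · rw [mem_halfDisc_iff (one_pos.trans_le (hinf k))] at hz
    refine Or.inl ((norm_sub_half_lt_iff z).2 (lt_of_le_of_lt ?_ hz))
    exact le_mul_of_one_le_left (Complex.normSq_nonneg z) (hinf k)

theorem resolventSetStar_subset_interior {X : Type*} [AddCommGroup X] [Module ℂ X]
    [TopologicalSpace X] [IsTopologicalAddGroup X] [ContinuousSMul ℂ X] (T : X →L[ℂ] X) :
    resolventSetStar T ⊆ interior (resolventSet ℂ T) := by
  rintro z ⟨δ, hδ, h, -⟩
  exact mem_interior_iff_mem_nhds.2 (mem_of_superset (Metric.ball_mem_nhds z hδ) h)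

theorem proposition2 (α : ℕ → ℝ) (h_one : ∀ n, 1 < α n) (h_mono : StrictMono α)
    (h_top : Tendsto α atTop atTop) (hS : (exponentSet α 0).Nonempty) :
    ¬ IsNuclearSpace (PowerSeriesZero α) ∧
    (∀ k, (exponentSet α k).Nonempty ∧ 1 ≤ exponentInf α k) ∧
    {z : ℂ | ‖z - 1 / 2‖ < 1 / 2} ∪ {1} = (⋃ k, halfDisc (exponentInf α k)) ∪ recipSet ∧
    {z : ℂ | ‖z - 1 / 2‖ < 1 / 2} ∪ {1} ⊆ spectrum ℂ (cesaroPower α h_mono.monotone) ∧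
    spectrum ℂ (cesaroPower α h_mono.monotone) ⊆
      ⋃ k, spectrum ℂ
        (cesaroWeighted (powerWeight α k) (powerWeight_antitone h_mono.monotone k)) ∧
    (⋃ k, spectrum ℂ
        (cesaroWeighted (powerWeight α k) (powerWeight_antitone h_mono.monotone k))) ⊆
      {z : ℂ | ‖z - 1 / 2‖ ≤ 1 / 2} ∧
    spectrumStar (cesaroPower α h_mono.monotone) =
      closure (spectrum ℂ (cesaroPower α h_mono.monotone)) ∧
    closure (spectrum ℂ (cesaroPower α h_mono.monotone)) = {z : ℂ | ‖z - 1 / 2‖ ≤ 1 / 2} := by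
  have hα : ∀ n, 0 ≤ α n := fun n => (one_pos.trans (h_one n)).le
  obtain ⟨s, B, -, -, hexp⟩ := exists_exp_div_le hS
  have hne : ∀ k, (exponentSet α k).Nonempty ∧ 1 ≤ exponentInf α k := fun k =>
    ⟨⟨_, mem_exponentSet_of_le (hexp k)⟩, le_csInf ⟨_, mem_exponentSet_of_le (hexp k)⟩
      fun t ht => (one_lt_of_mem_exponentSet hα ht).le⟩
  have hlow : {z : ℂ | ‖z - 1 / 2‖ < 1 / 2} ∪ {1} ⊆
      spectrum ℂ (cesaroPower α h_mono.monotone) := fun z hz =>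
    mem_spectrum_cesaroPower h_mono.monotone hS hz
  have hmid : spectrum ℂ (cesaroPower α h_mono.monotone) ⊆ ⋃ k, spectrum ℂ
      (cesaroWeighted (powerWeight α k) (powerWeight_antitone h_mono.monotone k)) := by
    intro z hz
    by_contra hcon
    simp only [Set.mem_iUnion, not_exists] at hcon
    exact hz (KotheZero.mem_resolventSet_cesaro_of_forall (powerWeight_antitone h_mono.monotone)
      (powerWeight_monotone hα) fun k => not_not.1 (hcon k))
  have hup : (⋃ k, spectrum ℂ
      (cesaroWeighted (powerWeight α k) (powerWeight_antitone h_mono.monotone k))) ⊆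
      {z : ℂ | ‖z - 1 / 2‖ ≤ 1 / 2} := by
    refine Set.iUnion_subset fun k z hz => ?_
    by_contra hcon
    obtain ⟨h0, h1⟩ := ne_zero_and_inv_re_lt_one hcon
    obtain ⟨M, -, hM⟩ := KotheZero.exists_cesaro_resolvent_bound h0 h1
    exact hz (hM fun _ : Unit => powerWeight_antitone h_mono.monotone k).1
  have hclosed : IsClosed {z : ℂ | ‖z - 1 / 2‖ ≤ 1 / 2} :=
    isClosed_le (by fun_prop) continuous_const
  have hcl : closure (spectrum ℂ (cesaroPower α h_mono.monotone)) =
      {z : ℂ | ‖z - 1 / 2‖ ≤ 1 / 2} := by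
    refine Set.Subset.antisymm (closure_minimal (hmid.trans hup) hclosed) ?_
    have h1 : {z : ℂ | ‖z - 1 / 2‖ ≤ 1 / 2} = Metric.closedBall (1 / 2 : ℂ) (1 / 2) := by
      ext z; simp [dist_eq_norm]
    have h2 : {z : ℂ | ‖z - 1 / 2‖ < 1 / 2} = Metric.ball (1 / 2 : ℂ) (1 / 2) := by
      ext z; simp [dist_eq_norm]
    rw [h1, ← closure_ball (1 / 2 : ℂ) (by norm_num : (1 / 2 : ℝ) ≠ 0), ← h2]
    exact closure_mono (Set.subset_union_left.trans hlow)
  refine ⟨not_isNuclearSpace_powerSeriesZero hα hS, hne,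
    iUnion_halfDisc_union_recipSet hα hS fun k => (hne k).2, hlow, hmid, hup, ?_, hcl⟩
  refine Set.Subset.antisymm ?_ ?_
  · rw [hcl]
    refine Set.compl_subset_comm.1 fun z hz => ?_
    exact KotheZero.mem_resolventSetStar_cesaro (powerWeight_antitone h_mono.monotone)
      (hclosed.isOpen_compl.mem_nhds hz) fun w hw => ne_zero_and_inv_re_lt_one hw
  -- The set `ρ*` lies in the interior of `ρ`, whose complement is the closure of the spectrum.
  · have h := Set.compl_subset_compl.2
      (resolventSetStar_subset_interior (cesaroPower α h_mono.monotone))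
    rw [← closure_compl] at h
    exact h
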